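/- Let $A$ be a finite alphabet (possibly empty), $X=\{x_0,x_1,x_2,\dots\}$ a set of distinct variable symbols disjoint from $A$, and let $\mathrm{FIN}^A$ be the set of all functions $f:\mathbb N\to A\cup X$ that are eventually equal to $x_0$. For $f,g\in\mathrm{FIN}^A$ the sum $f+g$ is defined iff for every $n$ at least one of $f(n),g(n)$ is $x_0$; then $(f+g)(n)=f(n)$ if $f(n)\ne x_0$ and $(f+g)(n)=g(n)$ otherwise. Let $\ell(f)=\max\{k: x_k \text{ is a value of } f\}$. For $T\subseteq \mathrm{FIN}^A$ put $T_k=\{f\in T:\ell(f)=k\}$, and call $T$ a subsemigroup if $f+g\in T$ whenever $f,g\in T$ and $f+g$ is defined. A set $B\subseteq\mathrm{FIN}^A$ is adequate if for every finite $E\subseteq B$ (including $E=\varnothing$) there is $y\in B$ such that $x+y$ is defined for all $x\in E$. A map $F:\mathbb N\to A\cup X$ is strong if $F(0)=x_0$, every $x_i$ is a value of $F$, and $i\le j$ whenever $F(n)=x_i$, $F(m)=x_j$ and $n\le m$. It acts on $\mathrm{FIN}^A$ by $\tilde F[f](n)=F(k)$ if $f(n)=x_k$ with $k\ge1$, and $\tilde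 F[f](n)=f(n)$ if $f(n)\in A\cup\{x_0\}$. Let $\mathcal F$ be the collection of all these maps $\tilde F$. For $b\in A\cup X$, $f[b]$ is obtained from $f$ by replacing the value $x_1$ by $b$ everywhere. For ultrafilters $U,V$ on $\mathrm{FIN}^A$, say that $U+V$ is defined if for $U$-almost all $x$ and $V$-almost all $y$ the sum $x+y$ is defined, i.e. $\{x:\{y: x+y\text{ is defined}\}\in V\}\in U$; then $U+V$ is the ultrafilter of all $B$ with $\{x:\{y:x+y\in B\}\in V\}\in U$. Write $U\preccurlyeq V$ if $U+V$ and $V+U$ are defined and both are equal to $U$. For a map $h:\mathrm{FIN}^A\to\mathrm{FIN}^A$ let $h(U)=\{B: h^{-1}(B)\in U\}$; in particular $U[b]$ is the image of $U$ under $f\mapsto f[b]$. For $B\subseteq\mathrm{FIN}^A$ let ${}^\gamma B$ be the set of ultrafilters $U$ with $B\in U$ and $\{y: x+y\text{ is defined}\}\in U$ for every $x\in B$. (These are the ultrafilter forms, $U=U_\alpha=\{B:\alpha\in{}^*B\}$, of the corresponding notions for elements $\alpha$ of the nonstandard extension of $\mathrm{FIN}^A$; $U_\alpha+U_\beta$ corresponds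 to $\alpha+{}^*\beta$.) A subsemigroup $T$ is complete if for every $U\in{}^\gamma T_1$ and every $k\ge1$ the sum $U+U[x_2]+\cdots+U[x_k]$ (bracketed to the left) is defined and contains $T$ as an element. A sequence $(U_i)_{i\in\mathbb N}$ is $\mathcal F$-coherent if for every $\tilde F\in\mathcal F$ and every $j$ there is $k\le j$ with $\tilde F(U_j)=U_k$. The set $T$ is $\mathcal F$-Ramsey if there is an $\mathcal F$-coherent sequence $(U_i)\in\prod_{i=0}^\infty{}^\gamma T_i$ such that $U_j\preccurlyeq U_i$ for all $i\le j$. **Theorem.** Let $T\subseteq\mathrm{FIN}^A$ be a subsemigroup such that every layer $T_i$ $(i\in\mathbb N)$ is adequate and $\tilde F[f]\in T$ for every strong $F$ and every $f\in T$. If $T$ is complete, then $T$ is $\mathcal F$-Ramsey. -/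

import Mathlib

/-- The symbols `A ∪ X`: `Sum.inl a` is the letter `a`, `Sum.inr i` is the variable `x_i`. -/
abbrev Symb (A : Type*) := A ⊕ ℕ

/-- `FIN^A`: the total functions `ℕ → A ∪ X` that are eventually equal to `x_0`. -/
def FinA (A : Type*) := {f : ℕ → Symb A // ∃ N, ∀ n, N ≤ n → f n = Sum.inr 0}

namespace FinA

variable {A : Type*}

/-- `f + g` is defined: at every place at least one of `f`, `g` is `x_0`. -/
def Compat (f g : FinA A) : Prop :=
  ∀ n, f.1 n = Sum.inr 0 ∨ g.1 n = Sum.inr 0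

open Classical in
/-- The sum `f + g`. It is only meaningful when `Compat f g` holds. -/
noncomputable def add (f g : FinA A) : FinA A :=
  ⟨fun n => if f.1 n = Sum.inr 0 then g.1 n else f.1 n, by
    obtain ⟨N, hN⟩ := f.2
    obtain ⟨M, hM⟩ := g.2
    refine ⟨max N M, fun n hn => ?_⟩
    simp [hN n (le_trans (le_max_left _ _) hn), hM n (le_trans (le_max_right _ _) hn)]⟩

/-- `ℓ(f) = k`, where `ℓ(f)` is the largest `k` such that `x_k` is a value of `f`. -/
def HasLayer (f : FinA A) (k : ℕ) : Prop :=
  IsGreatest {i : ℕ | ∃ n, f.1 n = Sum.inr i} k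

/-- The layer `T_k = {f ∈ T : ℓ(f) = k}`. -/
def layerOf (T : Set (FinA A)) (k : ℕ) : Set (FinA A) := {f ∈ T | f.HasLayer k}

/-- Strong maps `F : ℕ → A ∪ X`: `F 0 = x_0`, and all the `x_i` appear as values of `F`, in
increasing order. -/
structure IsStrong (F : ℕ → Symb A) : Prop where
  map_zero : F 0 = Sum.inr 0
  appears : ∀ i : ℕ, ∃ n, F n = Sum.inr i
  increasing : ∀ n m i j : ℕ, n ≤ m → F n = Sum.inr i → F m = Sum.inr j → i ≤ j

/-- The action of `F` on symbols: `x_k ↦ F k` for `k ≥ 1`; `x_0` and the letters are fixed. -/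
def actSymb (F : ℕ → Symb A) : Symb A → Symb A
  | Sum.inl a => Sum.inl a
  | Sum.inr 0 => Sum.inr 0
  | Sum.inr (k + 1) => F (k + 1)

/-- The map `f ↦ F̃[f]` on `FIN^A`. -/
def act (F : ℕ → Symb A) (f : FinA A) : FinA A :=
  ⟨fun n => actSymb F (f.1 n), by
    obtain ⟨N, hN⟩ := f.2
    exact ⟨N, fun n hn => by simp [hN n hn, actSymb]⟩⟩

/-- Substitution of `b` for `x_1` in a symbol. -/
def substSymb (b : Symb A) : Symb A → Symb A
  | Sum.inr 1 => b
  | s => s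

/-- `f[b]`: the value of `f[b]` is `b` wherever `f` has the value `x_1`, and that of `f`
elsewhere. -/
def subst (b : Symb A) (f : FinA A) : FinA A :=
  ⟨fun n => substSymb b (f.1 n), by
    obtain ⟨N, hN⟩ := f.2
    exact ⟨N, fun n hn => by simp [hN n hn, substSymb]⟩⟩

/-- `T` is a subsemigroup of the partial semigroup `FIN^A`. -/
def IsSubsemigroup (T : Set (FinA A)) : Prop :=
  ∀ f ∈ T, ∀ g ∈ T, Compat f g → add f g ∈ T

/-- Adequacy: every finite subset (also the empty one) has a `y ∈ B` that can be added to all of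
its elements. -/
def IsAdequate (B : Set (FinA A)) : Prop :=
  ∀ s : Set (FinA A), s.Finite → s ⊆ B → ∃ y ∈ B, ∀ x ∈ s, Compat x y

/-! Elements `α` of the nonstandard extension of `FIN^A` are represented, up to `u`-equivalence, by
the ultrafilters `U_α = {B : α ∈ *B}`. Then `α ∼ β` reads `U_α = U_β`, `α ∈ *B` reads `B ∈ U_α`,
`U_{f(α)}` is the image of `U_α` under `f`, and `α + *β ∈ **B` reads
`{x : {y : x + y ∈ B} ∈ U_β} ∈ U_α`. -/

/-- `α + *β` is defined. -/
def USumDefined (U V : Ultrafilter (FinA A)) : Prop :=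
  ∀ᶠ x in (U : Filter (FinA A)), ∀ᶠ y in (V : Filter (FinA A)), Compat x y

/-- The ultrafilter of `α + *β`: a set `B` belongs to it iff for `U`-almost all `x` and
`V`-almost all `y` we have `x + y ∈ B`. It is only meaningful when `USumDefined U V` holds. -/
noncomputable def usum (U V : Ultrafilter (FinA A)) : Ultrafilter (FinA A) :=
  U.bind fun x => V.map fun y => add x y

/-- `α ≼ β`, i.e. `α + *β ∼ β + *α ∼ α` (both sums being defined). -/
def UBelow (U V : Ultrafilter (FinA A)) : Prop :=
  USumDefined U V ∧ USumDefined V U ∧ usum U V = U ∧ usum V U = U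

/-- `γB`: the `α ∈ *B` such that `x + α` is defined for all `x ∈ B`. -/
def gam (B : Set (FinA A)) : Set (Ultrafilter (FinA A)) :=
  {U | B ∈ U ∧ ∀ x ∈ B, ∀ᶠ y in (U : Filter (FinA A)), Compat x y}

/-- `multiSum U n` is the ultrafilter of `α + *α[x_2] + **α[x_3] + ⋯`, with `n + 1` summands, the
last one being a substitution of `x_{n+1}`. -/
noncomputable def multiSum (U : Ultrafilter (FinA A)) : ℕ → Ultrafilter (FinA A)
  | 0 => U
  | n + 1 => usum (multiSum U n) (U.map (subst (Sum.inr (n + 2))))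

/-- `T` is complete: for every `α ∈ γT_1` and every number `k = n + 1 ≥ 1` of summands, the sum
`α + *α[x_2] + ⋯ + α[x_k]` (the last summand starred `k - 1` times) is defined and belongs to the
`k`-fold nonstandard extension of `T`. -/
def IsComplete (T : Set (FinA A)) : Prop :=
  ∀ U ∈ gam (layerOf T 1), ∀ n : ℕ,
    (∀ m < n, USumDefined (multiSum U m) (U.map (subst (Sum.inr (m + 2))))) ∧ T ∈ multiSum U n

/-- `Π_T`, the product of all the `γT_i`. -/
def piT (T : Set (FinA A)) : Set (ℕ → Ultrafilter (FinA A)) :=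
  {u | ∀ i, u i ∈ gam (layerOf T i)}

/-- Coherence of a sequence for the collection of all strong maps. -/
def IsCoherent (u : ℕ → Ultrafilter (FinA A)) : Prop :=
  ∀ F : ℕ → Symb A, IsStrong F → ∀ j, ∃ k ≤ j, (u j).map (act F) = u k

/-- `T` is `ℱ`-Ramsey, for the collection `ℱ` of all strong maps: some coherent
`(α_i) ∈ Π_T` satisfies `α_j ≼ α_i` for all `i ≤ j`. -/
def IsFRamsey (T : Set (FinA A)) : Prop :=
  ∃ u ∈ piT T, IsCoherent u ∧ ∀ i j, i ≤ j → UBelow (u j) (u i)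

end FinA

/-!
The sum of `FIN^A`, extended to all pairs by letting the left summand win, makes `FIN^A` a
semigroup, so that the ultrafilters on it form a compact semigroup in which `U ↦ U + V` is
continuous. Since an element has finite support, `U ∈ γT_i` just means that `T_i ∈ U` and that
every coordinate is `U`-almost surely `x_0` (`mem_gam_layerOf_iff`). Sums of such *free*
ultrafilters are automatically defined, and the maps `F̃` and `f ↦ f[b]` respect them.

Call `u ∈ Π_T` *strictly coherent* if `F̃(u_j) = u_k`, where `x_k` is the largest variable among
`F 0, …, F j`. The proof has two parts.

* A strictly coherent sequence exists (`exists_mem_strictCoherent`). As in the ultrafilter proof of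
  the Hales–Jewett theorem, take a minimal idempotent `U_0` of `γT_0` and an idempotent `U_1 ≼ U_0`
  in `γT_1`. Substituting a letter or `x_0` for `x_1` yields an idempotent of `γT_0` below `U_0`,
  hence `U_0` itself. Then `V_j = U_0 + U_1[x_1] + ⋯ + U_1[x_j]` is strictly coherent: `F̃` replaces
  each summand by `U_0`, by a copy of the preceding variable summand, or by the next one, and the
  first two are absorbed. Completeness says that `T ∈ V_j`.
* The strictly coherent sequences form a compact semigroup `C` under pointwise sums. If `v ∈ C` is
  idempotent, then the sums `v_0 + ⋯ + v_j` and `v_j + ⋯ + v_0` both define elements of `C`. Given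
  `u ∈ C` with `u_0 ≽ ⋯ ≽ u_n`, the `v ∈ C` that agree with `u` up to `n` and satisfy
  `v_{n+1} + u_n = v_{n+1}` form a compact semigroup, nonempty because of the reversed sums. The
  partial sums of an idempotent in it agree with `u` up to `n` and are decreasing up to `n + 1`
  (`exists_orderedUpTo_succ`). A diagonal sequence of these is decreasing throughout.
-/

open Filter Topology

/-! ### Minimal idempotents -/

/-- A compact semigroup in which the maps `x ↦ x + r` are continuous has an idempotent that is
minimal for the order `q ≼ p ↔ p + q = q ∧ q + p = q`: any idempotent of a minimal closed left
ideal will do. -/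
theorem exists_minimal_idempotent {M : Type*} [AddSemigroup M] [TopologicalSpace M] [T2Space M]
    (hcont : ∀ r : M, Continuous (· + r)) (S : Set M) (hne : S.Nonempty) (hS : IsCompact S)
    (hadd : ∀ x ∈ S, ∀ y ∈ S, x + y ∈ S) :
    ∃ p ∈ S, p + p = p ∧ ∀ q ∈ S, q + q = q → p + q = q → q + p = q → q = p := by
  let Z : Set (Set M) := {L | IsClosed L ∧ L.Nonempty ∧ L ⊆ S ∧ ∀ s ∈ S, ∀ x ∈ L, s + x ∈ L}
  obtain ⟨L, -, hL⟩ : ∃ L, L ⊆ S ∧ Minimal (· ∈ Z) L := by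
    refine zorn_superset_nonempty Z (fun c hcZ hc hcne => ?_) S
      ⟨hS.isClosed, hne, subset_rfl, hadd⟩
    refine ⟨⋂₀ c, ⟨isClosed_sInter fun t ht => (hcZ ht).1, ?_, ?_, fun s hs x hx t ht =>
      (hcZ ht).2.2.2 s hs x (hx t ht)⟩, fun t ht => Set.sInter_subset_of_mem ht⟩
    · have : Nonempty c := hcne.coe_sort
      rw [Set.sInter_eq_iInter]
      exact IsCompact.nonempty_iInter_of_directed_nonempty_isCompact_isClosed _
        (DirectedOn.directed_val (IsChain.directedOn hc.symm)) (fun i => (hcZ i.2).2.1)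
        (fun i => hS.of_isClosed_subset (hcZ i.2).1 (hcZ i.2).2.2.1) fun i => (hcZ i.2).1
    · obtain ⟨t, ht⟩ := hcne
      exact (Set.sInter_subset_of_mem ht).trans (hcZ ht).2.2.1
  obtain ⟨hLc, hLne, hLS, hLadd⟩ := hL.prop
  obtain ⟨p, hpL, hp⟩ := exists_idempotent_in_compact_add_subsemigroup hcont L hLne
    (hS.of_isClosed_subset hLc hLS) fun x hx y hy => hLadd x (hLS hx) y hy
  refine ⟨p, hLS hpL, hp, fun q hq hqq hpq hqp => ?_⟩
  have hqL : q ∈ L := hqp ▸ hLadd q hq p hpL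
  have himg : (· + q) '' S = L := by
    refine hL.eq_of_subset ⟨(hS.image (hcont q)).isClosed, hne.image _, ?_, ?_⟩ ?_
    · rintro _ ⟨s, hs, rfl⟩
      exact hadd s hs q hq
    · rintro s hs _ ⟨t, ht, rfl⟩
      exact ⟨s + t, hadd s hs t ht, add_assoc _ _ _⟩
    · rintro _ ⟨s, hs, rfl⟩
      exact hLadd s hs q hqL
  obtain ⟨s, -, hs : s + q = p⟩ : p ∈ (· + q) '' S := himg ▸ hpL
  have : p + q = p := by rw [← hs, add_assoc, hqq]
  exact hpq.symm.trans this

/-- If `p` is idempotent and `S` is a compact subsemigroup with `p + S ⊆ S` and `S + p ⊆ S`, then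
`S` has an idempotent below `p`: take an idempotent `e` in the compact semigroup `S + p`; then
`p + e` will do. -/
theorem exists_idempotent_below {M : Type*} [AddSemigroup M] [TopologicalSpace M] [T2Space M]
    (hcont : ∀ r : M, Continuous (· + r)) {p : M} (hp : p + p = p) (S : Set M) (hne : S.Nonempty)
    (hS : IsCompact S) (hadd : ∀ x ∈ S, ∀ y ∈ S, x + y ∈ S) (hleft : ∀ x ∈ S, p + x ∈ S)
    (hright : ∀ x ∈ S, x + p ∈ S) : ∃ q ∈ S, q + q = q ∧ p + q = q ∧ q + p = q := by
  obtain ⟨e, ⟨s, hs, hse⟩, hee⟩ := exists_idempotent_in_compact_add_subsemigroup hcont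
    ((· + p) '' S) (hne.image _) (hS.image (hcont p)) (by
      rintro _ ⟨s, hs, rfl⟩ _ ⟨t, ht, rfl⟩
      exact ⟨s + p + t, hadd _ (hright s hs) t ht, add_assoc _ _ _⟩)
  have hse : s + p = e := hse
  have hep : e + p = e := by rw [← hse, add_assoc, hp]
  refine ⟨p + e, hleft e (hse ▸ hright s hs), ?_, ?_, ?_⟩
  · rw [add_assoc, ← add_assoc e, hep, hee]
  · rw [← add_assoc, hp]
  · rw [add_assoc, hep]

theorem continuous_ultrafilter_map {X Y : Type*} (f : X → Y) :
    Continuous (Ultrafilter.map f) :=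
  ultrafilterBasis_is_basis.continuous_iff.2 <| Set.forall_mem_range.mpr fun s =>
    ultrafilter_isOpen_basic (f ⁻¹' s)

namespace FinA

variable {A : Type*}

/-! ### The semigroup of ultrafilters -/

theorem add_apply_of_eq {f g : FinA A} {n : ℕ} (h : f.1 n = Sum.inr 0) :
    (add f g).1 n = g.1 n := if_pos h

theorem add_apply_of_ne {f g : FinA A} {n : ℕ} (h : f.1 n ≠ Sum.inr 0) :
    (add f g).1 n = f.1 n := if_neg h

/-- `FinA.add` is associative on all of `FIN^A`, also where the sums are not defined. -/
noncomputable instance instAddSemigroup : AddSemigroup (FinA A) where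
  add := add
  add_assoc f g h := by
    refine Subtype.ext (funext fun n => ?_)
    change (add (add f g) h).1 n = (add f (add g h)).1 n
    by_cases hf : f.1 n = Sum.inr 0
    · rw [add_apply_of_eq hf]
      by_cases hg : g.1 n = Sum.inr 0
      · rw [add_apply_of_eq hg, add_apply_of_eq ((add_apply_of_eq hf).trans hg)]
      · rw [add_apply_of_ne hg, add_apply_of_ne (by rwa [add_apply_of_eq hf]),
          add_apply_of_eq hf]
    · rw [add_apply_of_ne hf, add_apply_of_ne (by rwa [add_apply_of_ne hf]), add_apply_of_ne hf]

noncomputable instance instAddSemigroupUltrafilter : AddSemigroup (Ultrafilter (FinA A)) :=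
  Ultrafilter.addSemigroup

theorem usum_eq_add (U V : Ultrafilter (FinA A)) : usum U V = U + V := rfl

theorem eventually_uadd (U V : Ultrafilter (FinA A)) (p : FinA A → Prop) :
    (∀ᶠ z in ((U + V : Ultrafilter (FinA A)) : Filter (FinA A)), p z) ↔
      ∀ᶠ x in (U : Filter (FinA A)), ∀ᶠ y in (V : Filter (FinA A)), p (add x y) :=
  Iff.rfl

theorem continuous_uadd (V : Ultrafilter (FinA A)) : Continuous (· + V) :=
  Ultrafilter.continuous_add_left V

/-- `U` is free if each coordinate of `U`-almost all `y` is `x_0`. -/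
def IsFree (U : Ultrafilter (FinA A)) : Prop :=
  ∀ n, ∀ᶠ y in (U : Filter (FinA A)), y.1 n = Sum.inr 0

theorem IsFree.eventually_compat {U : Ultrafilter (FinA A)} (hU : IsFree U) (x : FinA A) :
    ∀ᶠ y in (U : Filter (FinA A)), Compat x y := by
  obtain ⟨N, hN⟩ := x.2
  have h : ∀ᶠ y in (U : Filter (FinA A)), ∀ n ∈ Finset.range N, y.1 n = Sum.inr 0 :=
    (Filter.eventually_all_finset _).2 fun n _ => hU n
  filter_upwards [h] with y hy n
  rcases lt_or_ge n N with hn | hn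
  · exact Or.inr (hy n (Finset.mem_range.2 hn))
  · exact Or.inl (hN n hn)

theorem IsFree.uSumDefined (U : Ultrafilter (FinA A)) {V : Ultrafilter (FinA A)}
    (hV : IsFree V) : USumDefined U V :=
  Eventually.of_forall hV.eventually_compat

theorem IsFree.add {U V : Ultrafilter (FinA A)} (hU : IsFree U) (hV : IsFree V) :
    IsFree (U + V) := fun n => by
  rw [eventually_uadd]
  filter_upwards [hU n] with x hx
  filter_upwards [hV n] with y hy
  exact (add_apply_of_eq hx).trans hy

/-- If no element of `B` is nonzero at a coordinate `n`, then freeness at `n` follows from `B ∈ U`;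
otherwise it follows from compatibility with an element that is nonzero at `n`. -/
theorem mem_gam_iff {B : Set (FinA A)} {U : Ultrafilter (FinA A)} :
    U ∈ gam B ↔ B ∈ U ∧ IsFree U := by
  refine ⟨fun ⟨hB, h⟩ => ⟨hB, fun n => ?_⟩, fun ⟨hB, h⟩ => ⟨hB, fun x _ => h.eventually_compat x⟩⟩
  by_cases hn : ∃ x ∈ B, x.1 n ≠ Sum.inr 0
  · obtain ⟨x, hx, hxn⟩ := hn
    filter_upwards [h x hx] with y hy
    exact (hy n).resolve_left hxn
  · push Not at hn
    filter_upwards [hB] with y hy using hn y hy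

theorem isClosed_gam (B : Set (FinA A)) : IsClosed (gam B) := by
  have : gam B = {U : Ultrafilter (FinA A) | B ∈ U} ∩
      ⋂ n, {U : Ultrafilter (FinA A) | {y : FinA A | y.1 n = Sum.inr 0} ∈ U} := by
    ext U
    rw [mem_gam_iff, Set.mem_inter_iff, Set.mem_iInter]
    rfl
  rw [this]
  exact (ultrafilter_isClosed_basic _).inter
    (isClosed_iInter fun n => ultrafilter_isClosed_basic _)

theorem IsAdequate.nonempty_gam {B : Set (FinA A)} (hB : IsAdequate B) : (gam B).Nonempty := by
  have hne : (𝓟 B ⊓ ⨅ x : B, 𝓟 {y | Compat x.1 y}).NeBot := by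
    rw [inf_comm, ((Filter.hasBasis_iInf_principal_finite _).inf_principal B).neBot_iff]
    intro t ht
    obtain ⟨y, hyB, hy⟩ := hB (Subtype.val '' t) (ht.image _) (by simp)
    exact ⟨y, Set.mem_iInter₂.2 fun x hx => hy x ⟨x, hx, rfl⟩, hyB⟩
  refine ⟨@Ultrafilter.of _ _ hne, ?_, fun x hx => ?_⟩
  · exact Ultrafilter.of_le _ (mem_inf_of_left (mem_principal_self B))
  · exact Ultrafilter.of_le _
      (mem_inf_of_right (mem_iInf_of_mem ⟨x, hx⟩ (mem_principal_self _)))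

/-! ### Maps induced by maps of symbols -/

/-- `h` applies to every coordinate a map of symbols that fixes `x_0`. -/
def IsSymbolwise (h : FinA A → FinA A) : Prop :=
  ∃ σ : Symb A → Symb A, σ (Sum.inr 0) = Sum.inr 0 ∧ ∀ f n, (h f).1 n = σ (f.1 n)

theorem isSymbolwise_act (F : ℕ → Symb A) : IsSymbolwise (act F) :=
  ⟨actSymb F, rfl, fun _ _ => rfl⟩

theorem isSymbolwise_subst (b : Symb A) : IsSymbolwise (subst b) :=
  ⟨substSymb b, rfl, fun _ _ => rfl⟩

/-- Compatibility is needed: `h` may send a nonzero value of `f` to `x_0`. -/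
theorem IsSymbolwise.map_add_of_compat {h : FinA A → FinA A} (hh : IsSymbolwise h) {f g : FinA A}
    (hfg : Compat f g) : h (add f g) = add (h f) (h g) := by
  obtain ⟨σ, h0, hσ⟩ := hh
  refine Subtype.ext (funext fun n => ?_)
  by_cases hf : f.1 n = Sum.inr 0
  · rw [hσ, add_apply_of_eq hf, add_apply_of_eq (by rw [hσ, hf, h0]), hσ]
  · rw [hσ, add_apply_of_ne hf]
    by_cases hs : σ (f.1 n) = Sum.inr 0
    · rw [add_apply_of_eq (by rw [hσ, hs]), hσ, (hfg n).resolve_left hf, hs, h0]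
    · rw [add_apply_of_ne (by rwa [hσ]), hσ]

theorem IsSymbolwise.map_uadd {h : FinA A → FinA A} (hh : IsSymbolwise h)
    (U : Ultrafilter (FinA A)) {V : Ultrafilter (FinA A)} (hV : IsFree V) :
    (U + V).map h = U.map h + V.map h := by
  refine Ultrafilter.coe_inj.mp (Filter.ext' fun p => ?_)
  change (∀ᶠ x in (U : Filter (FinA A)), ∀ᶠ y in (V : Filter (FinA A)), p (h (FinA.add x y))) ↔
    ∀ᶠ x in (U : Filter (FinA A)), ∀ᶠ y in (V : Filter (FinA A)), p (FinA.add (h x) (h y))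
  refine eventually_congr (Eventually.of_forall fun x => eventually_congr ?_)
  filter_upwards [hV.eventually_compat x] with y hy
  rw [hh.map_add_of_compat hy]

theorem IsSymbolwise.isFree_map {h : FinA A → FinA A} (hh : IsSymbolwise h)
    {U : Ultrafilter (FinA A)} (hU : IsFree U) : IsFree (U.map h) := fun n => by
  obtain ⟨σ, h0, hσ⟩ := hh
  change ∀ᶠ y in (U : Filter (FinA A)), (h y).1 n = Sum.inr 0
  filter_upwards [hU n] with y hy
  rw [hσ, hy, h0]

theorem map_congr_of_eventually {h h' : FinA A → FinA A} {U : Ultrafilter (FinA A)}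
    (H : ∀ᶠ f in (U : Filter (FinA A)), h f = h' f) : U.map h = U.map h' :=
  Ultrafilter.coe_inj.mp (Filter.map_congr H)

theorem map_eq_self_of_eventually {h : FinA A → FinA A} {U : Ultrafilter (FinA A)}
    (H : ∀ᶠ f in (U : Filter (FinA A)), h f = f) : U.map h = U :=
  (map_congr_of_eventually H).trans U.map_id

/-! ### Layers -/

theorem HasLayer.add {f g : FinA A} {j k : ℕ} (hf : f.HasLayer j) (hg : g.HasLayer k)
    (hfg : Compat f g) : (add f g).HasLayer (max j k) := by
  constructor
  · rcases Nat.eq_zero_or_pos (max j k) with h0 | hpos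
    · obtain ⟨N, hN⟩ := (FinA.add f g).2
      exact ⟨N, by rw [h0]; exact hN N le_rfl⟩
    · rcases le_total j k with hjk | hkj
      · rw [max_eq_right hjk] at hpos ⊢
        obtain ⟨n, hn⟩ := hg.1
        have : f.1 n = Sum.inr 0 := (hfg n).resolve_right (by rw [hn]; simpa using hpos.ne')
        exact ⟨n, (add_apply_of_eq this).trans hn⟩
      · rw [max_eq_left hkj] at hpos ⊢
        obtain ⟨n, hn⟩ := hf.1
        exact ⟨n, (add_apply_of_ne (by rw [hn]; simpa using hpos.ne')).trans hn⟩
  · rintro i ⟨n, hn⟩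
    by_cases h : f.1 n = Sum.inr 0
    · rw [add_apply_of_eq h] at hn
      exact le_max_of_le_right (hg.2 ⟨n, hn⟩)
    · rw [add_apply_of_ne h] at hn
      exact le_max_of_le_left (hf.2 ⟨n, hn⟩)

theorem eventually_hasLayer_uadd {U V : Ultrafilter (FinA A)} {j k : ℕ} (hV : IsFree V)
    (hUj : ∀ᶠ f in (U : Filter (FinA A)), f.HasLayer j)
    (hVk : ∀ᶠ f in (V : Filter (FinA A)), f.HasLayer k) :
    ∀ᶠ f in ((U + V : Ultrafilter (FinA A)) : Filter (FinA A)), f.HasLayer (max j k) := by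
  rw [eventually_uadd]
  filter_upwards [hUj] with x hx
  filter_upwards [hVk, hV.eventually_compat x] with y hy hxy
  exact hx.add hy hxy

theorem mem_gam_layerOf_iff {T : Set (FinA A)} {k : ℕ} {U : Ultrafilter (FinA A)} :
    U ∈ gam (layerOf T k) ↔
      T ∈ U ∧ (∀ᶠ f in (U : Filter (FinA A)), f.HasLayer k) ∧ IsFree U := by
  rw [mem_gam_iff, ← and_assoc]
  exact and_congr_left' Filter.inter_mem_iff

theorem isFree_of_mem_gam {B : Set (FinA A)} {U : Ultrafilter (FinA A)} (hU : U ∈ gam B) :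
    IsFree U := (mem_gam_iff.1 hU).2

theorem add_mem_gam_layerOf {T : Set (FinA A)} (hsub : IsSubsemigroup T) {j k l : ℕ}
    (hl : max j k = l) {U V : Ultrafilter (FinA A)} (hU : U ∈ gam (layerOf T j))
    (hV : V ∈ gam (layerOf T k)) : U + V ∈ gam (layerOf T l) := by
  subst hl
  obtain ⟨hUT, hUj, hUf⟩ := mem_gam_layerOf_iff.1 hU
  obtain ⟨hVT, hVk, hVf⟩ := mem_gam_layerOf_iff.1 hV
  refine mem_gam_layerOf_iff.2 ⟨?_, eventually_hasLayer_uadd hVf hUj hVk, hUf.add hVf⟩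
  change ∀ᶠ f in ((U + V : Ultrafilter (FinA A)) : Filter (FinA A)), f ∈ T
  rw [eventually_uadd]
  filter_upwards [hUT] with x hx
  filter_upwards [hVT, hVf.eventually_compat x] with y hy hxy
  exact hsub x hx y hy hxy

theorem HasLayer.subst_eq_self {f : FinA A} (hf : f.HasLayer 0) (b : Symb A) :
    subst b f = f := by
  refine Subtype.ext (funext fun n => ?_)
  change substSymb b (f.1 n) = f.1 n
  unfold substSymb
  split
  · next h => exact absurd (hf.2 ⟨n, h⟩) (by norm_num)
  · rfl

/-- The values of `f[b]` for `f` of layer `1`. -/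
theorem HasLayer.subst_apply_cases {f : FinA A} (hf : f.HasLayer 1) (n : ℕ) :
    (f.1 n = Sum.inr 1 ∧ ∀ b, (subst b f).1 n = b) ∨
      (f.1 n ≠ Sum.inr 1 ∧ (∀ b, (subst b f).1 n = f.1 n) ∧
        ∀ i, f.1 n = Sum.inr i → i = 0) := by
  by_cases h : f.1 n = Sum.inr 1
  · refine Or.inl ⟨h, fun b => ?_⟩
    change substSymb b (f.1 n) = b
    rw [h]
    rfl
  · refine Or.inr ⟨h, fun b => ?_, fun i hi => ?_⟩
    · change substSymb b (f.1 n) = f.1 n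
      unfold substSymb
      split
      · next h' => exact absurd h' h
      · rfl
    · have h1 : i ≤ 1 := hf.2 ⟨n, hi⟩
      have h2 : i ≠ 1 := fun h' => h (h' ▸ hi)
      omega

theorem HasLayer.subst_var {f : FinA A} (hf : f.HasLayer 1) (i : ℕ) :
    (subst (Sum.inr i) f).HasLayer i := by
  constructor
  · obtain ⟨n, hn⟩ := hf.1
    refine ⟨n, ?_⟩
    rcases hf.subst_apply_cases n with ⟨-, h⟩ | ⟨h, -⟩
    · exact h _
    · exact absurd hn h
  · rintro k ⟨n, hn⟩
    rcases hf.subst_apply_cases n with ⟨-, h⟩ | ⟨-, h, h'⟩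
    · rw [h] at hn
      exact (Sum.inr_injective hn).ge
    · rw [h] at hn
      exact (h' k hn).trans_le (Nat.zero_le i)

theorem HasLayer.subst_letter {f : FinA A} (hf : f.HasLayer 1) (a : A) :
    (subst (Sum.inl a) f).HasLayer 0 := by
  constructor
  · obtain ⟨N, hN⟩ := (subst (Sum.inl a) f).2
    exact ⟨N, hN N le_rfl⟩
  · rintro k ⟨n, hn⟩
    rcases hf.subst_apply_cases n with ⟨-, h⟩ | ⟨-, h, h'⟩
    · rw [h] at hn
      exact absurd hn Sum.inl_ne_inr
    · rw [h] at hn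
      exact (h' k hn).le

theorem actSymb_inr {F : ℕ → Symb A} (h0 : F 0 = Sum.inr 0) (i : ℕ) :
    actSymb F (Sum.inr i) = F i := by
  cases i with
  | zero => exact h0.symm
  | succ i => rfl

theorem HasLayer.act_subst_var {f : FinA A} (hf : f.HasLayer 1) {F : ℕ → Symb A}
    (h0 : F 0 = Sum.inr 0) (i : ℕ) : act F (subst (Sum.inr i) f) = subst (F i) f := by
  refine Subtype.ext (funext fun n => ?_)
  change actSymb F ((subst (Sum.inr i) f).1 n) = _
  rcases hf.subst_apply_cases n with ⟨-, h⟩ | ⟨-, h, h'⟩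
  · rw [h, h, actSymb_inr h0]
  · rw [h, h]
    rcases hs : f.1 n with a | k
    · rfl
    · rw [h' k hs]
      rfl

theorem subst_var_one (f : FinA A) : subst (Sum.inr 1) f = f := by
  refine Subtype.ext (funext fun n => ?_)
  change substSymb (Sum.inr 1) (f.1 n) = f.1 n
  unfold substSymb
  split
  · next h => exact h.symm
  · rfl

/-! ### Strictly coherent sequences -/

/-- The largest `k` such that `x_k` is `x_0` or one of `F 1, …, F j`. -/
def varBound (F : ℕ → Symb A) : ℕ → ℕ
  | 0 => 0
  | j + 1 => Sum.elim (fun _ => varBound F j) (fun i => max (varBound F j) i) (F (j + 1))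

theorem le_varBound (F : ℕ → Symb A) (h0 : F 0 = Sum.inr 0) {i : ℕ} :
    ∀ {n j : ℕ}, n ≤ j → F n = Sum.inr i → i ≤ varBound F j := by
  intro n j
  induction j with
  | zero =>
    intro hn hi
    rw [Nat.le_zero.1 hn, h0] at hi
    exact (Sum.inr_injective hi).ge
  | succ j ih =>
    intro hn hi
    rcases Nat.le_succ_iff.1 hn with h | h
    · refine (ih h hi).trans ?_
      rw [varBound]
      rcases F (j + 1) with a | k
      · exact le_rfl
      · exact le_max_left _ _
    · subst h
      rw [varBound, hi]
      exact le_max_right _ _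

theorem exists_eq_varBound (F : ℕ → Symb A) (h0 : F 0 = Sum.inr 0) (j : ℕ) :
    ∃ n ≤ j, F n = Sum.inr (varBound F j) := by
  induction j with
  | zero => exact ⟨0, le_rfl, h0⟩
  | succ j ih =>
    obtain ⟨n, hn, h⟩ := ih
    rw [varBound]
    rcases hF : F (j + 1) with a | k
    · exact ⟨n, hn.trans j.le_succ, h⟩
    · rcases le_total (varBound F j) k with hk | hk
      · exact ⟨j + 1, le_rfl, hF.trans (by simp [hk])⟩
      · exact ⟨n, hn.trans j.le_succ, h.trans (by simp [hk])⟩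

/-- A value of a strong map is a letter, the last variable seen so far, or the next one. -/
theorem IsStrong.varBound_succ_cases {F : ℕ → Symb A} (hF : IsStrong F) (j : ℕ) :
    (∃ a, F (j + 1) = Sum.inl a ∧ varBound F (j + 1) = varBound F j) ∨
    (F (j + 1) = Sum.inr (varBound F j) ∧ varBound F (j + 1) = varBound F j) ∨
    (F (j + 1) = Sum.inr (varBound F j + 1) ∧ varBound F (j + 1) = varBound F j + 1) := by
  rw [varBound]
  rcases h : F (j + 1) with a | i
  · exact Or.inl ⟨a, rfl, rfl⟩
  · right
    obtain ⟨n, hn, hFn⟩ := exists_eq_varBound F hF.map_zero j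
    have hge : varBound F j ≤ i := hF.increasing n (j + 1) _ _ (hn.trans j.le_succ) hFn h
    have hle : i ≤ varBound F j + 1 := by
      obtain ⟨m, hm⟩ := hF.appears (varBound F j + 1)
      rcases Nat.lt_or_ge j m with hjm | hmj
      · exact hF.increasing (j + 1) m _ _ hjm h hm
      · exact absurd (le_varBound F hF.map_zero hmj hm) (by omega)
    rcases Nat.le_succ_iff.1 hle with h1 | h1
    · obtain rfl := le_antisymm hge h1
      simp
    · subst h1
      simp

theorem IsStrong.varBound_le {F : ℕ → Symb A} (hF : IsStrong F) (j : ℕ) : varBound F j ≤ j := by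
  induction j with
  | zero => exact le_rfl
  | succ j ih => rcases hF.varBound_succ_cases j with ⟨a, -, h⟩ | ⟨-, h⟩ | ⟨-, h⟩ <;> omega

/-- The sequences in `Π_T` that every `F̃` maps according to `varBound F`. -/
def strictCoherent (T : Set (FinA A)) : Set (ℕ → Ultrafilter (FinA A)) :=
  {u | u ∈ piT T ∧ ∀ F, IsStrong F → ∀ j, (u j).map (act F) = u (varBound F j)}

theorem isFree_of_mem_strictCoherent {T : Set (FinA A)} {u : ℕ → Ultrafilter (FinA A)}
    (hu : u ∈ strictCoherent T) (i : ℕ) : IsFree (u i) := isFree_of_mem_gam (hu.1 i)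

theorem isClosed_strictCoherent (T : Set (FinA A)) : IsClosed (strictCoherent T) := by
  have : strictCoherent T = (⋂ i, {u | u i ∈ gam (layerOf T i)}) ∩
      ⋂ F : ℕ → Symb A, ⋂ _ : IsStrong F, ⋂ j,
        {u : ℕ → Ultrafilter (FinA A) | (u j).map (act F) = u (varBound F j)} := by
    ext u
    simp only [strictCoherent, piT, Set.mem_inter_iff, Set.mem_iInter, Set.mem_ofPred_eq]
  rw [this]
  refine (isClosed_iInter fun i => (isClosed_gam _).preimage (continuous_apply i)).inter
    (isClosed_iInter fun F => isClosed_iInter fun _ => isClosed_iInter fun j => isClosed_eq ?_ ?_)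
  · exact (continuous_ultrafilter_map _).comp (continuous_apply j)
  · exact continuous_apply _

theorem continuous_seq_add (r : ℕ → Ultrafilter (FinA A)) : Continuous (· + r) :=
  continuous_pi fun i => (continuous_uadd (r i)).comp (continuous_apply i)

theorem add_mem_strictCoherent {T : Set (FinA A)} (hsub : IsSubsemigroup T)
    {u v : ℕ → Ultrafilter (FinA A)} (hu : u ∈ strictCoherent T) (hv : v ∈ strictCoherent T) :
    u + v ∈ strictCoherent T := by
  refine ⟨fun i => ?_, fun F hF j => ?_⟩
  · exact add_mem_gam_layerOf hsub (by simp) (hu.1 i) (hv.1 i)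
  · rw [Pi.add_apply, (isSymbolwise_act F).map_uadd _ (isFree_of_mem_strictCoherent hv j),
      hu.2 F hF, hv.2 F hF, Pi.add_apply]

/-- `v_0 + v_1 + ⋯ + v_j`. -/
noncomputable def partialSum (v : ℕ → Ultrafilter (FinA A)) : ℕ → Ultrafilter (FinA A)
  | 0 => v 0
  | j + 1 => partialSum v j + v (j + 1)

/-- `v_j + ⋯ + v_1 + v_0`. -/
noncomputable def revPartialSum (v : ℕ → Ultrafilter (FinA A)) : ℕ → Ultrafilter (FinA A)
  | 0 => v 0
  | j + 1 => v (j + 1) + revPartialSum v j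

theorem partialSum_add_self {v : ℕ → Ultrafilter (FinA A)} {j : ℕ} (hv : v j + v j = v j) :
    partialSum v j + v j = partialSum v j := by
  cases j with
  | zero => exact hv
  | succ j => rw [partialSum, add_assoc, hv]

theorem self_add_revPartialSum {v : ℕ → Ultrafilter (FinA A)} {j : ℕ} (hv : v j + v j = v j) :
    v j + revPartialSum v j = revPartialSum v j := by
  cases j with
  | zero => exact hv
  | succ j => rw [revPartialSum, ← add_assoc, hv]

theorem partialSum_mem_strictCoherent {T : Set (FinA A)} (hsub : IsSubsemigroup T)
    {v : ℕ → Ultrafilter (FinA A)} (hv : v ∈ strictCoherent T) (hvv : ∀ i, v i + v i = v i) :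
    partialSum v ∈ strictCoherent T := by
  refine ⟨fun i => ?_, fun F hF j => ?_⟩
  · induction i with
    | zero => exact hv.1 0
    | succ i ih => exact add_mem_gam_layerOf hsub (by simp) ih (hv.1 (i + 1))
  · induction j with
    | zero => exact hv.2 F hF 0
    | succ j ih =>
      rw [partialSum, (isSymbolwise_act F).map_uadd _ (isFree_of_mem_strictCoherent hv _), ih,
        hv.2 F hF]
      rcases hF.varBound_succ_cases j with ⟨a, -, h⟩ | ⟨-, h⟩ | ⟨-, h⟩
      · rw [h, partialSum_add_self (hvv _)]
      · rw [h, partialSum_add_self (hvv _)]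
      · rw [h, partialSum]

theorem revPartialSum_mem_strictCoherent {T : Set (FinA A)} (hsub : IsSubsemigroup T)
    {v : ℕ → Ultrafilter (FinA A)} (hv : v ∈ strictCoherent T) (hvv : ∀ i, v i + v i = v i) :
    revPartialSum v ∈ strictCoherent T := by
  have hmem : revPartialSum v ∈ piT T := fun i => by
    induction i with
    | zero => exact hv.1 0
    | succ i ih => exact add_mem_gam_layerOf hsub (by simp) (hv.1 (i + 1)) ih
  refine ⟨hmem, fun F hF j => ?_⟩
  induction j with
  | zero => exact hv.2 F hF 0
  | succ j ih =>
    rw [revPartialSum, (isSymbolwise_act F).map_uadd _ (isFree_of_mem_gam (hmem j)), ih,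
      hv.2 F hF]
    rcases hF.varBound_succ_cases j with ⟨a, -, h⟩ | ⟨-, h⟩ | ⟨-, h⟩
    · rw [h, self_add_revPartialSum (hvv _)]
    · rw [h, self_add_revPartialSum (hvv _)]
    · rw [h, revPartialSum]

/-! ### Existence of a strictly coherent sequence -/

/-- The strong map `x_0, b, x_1, x_2, …`, whose action on words of layer `1` is `f ↦ f[b]`. -/
def shiftMap (b : Symb A) : ℕ → Symb A
  | 0 => Sum.inr 0
  | 1 => b
  | n + 2 => Sum.inr (n + 1)

theorem isStrong_shiftMap {b : Symb A} (hb : ∀ i, b = Sum.inr i → i = 0) :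
    IsStrong (shiftMap b) where
  map_zero := rfl
  appears i := by
    cases i with
    | zero => exact ⟨0, rfl⟩
    | succ i => exact ⟨i + 2, rfl⟩
  increasing n m i j hnm hn hm := by
    match n, m, hnm with
    | 0, _, _ => exact (Sum.inr_injective hn).ge.trans (Nat.zero_le j)
    | 1, _, _ => exact (hb i hn).le.trans (Nat.zero_le j)
    | n + 2, m + 2, h =>
      have h1 : n + 1 = i := Sum.inr_injective hn
      have h2 : m + 1 = j := Sum.inr_injective hm
      omega

theorem subst_mem_of_hasLayer_one {T : Set (FinA A)}
    (hstrong : ∀ F : ℕ → Symb A, IsStrong F → ∀ f ∈ T, act F f ∈ T) {b : Symb A}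
    (hb : ∀ i, b = Sum.inr i → i = 0) {f : FinA A} (hf : f ∈ layerOf T 1) :
    subst b f ∈ layerOf T 0 := by
  refine ⟨?_, ?_⟩
  · have := hstrong _ (isStrong_shiftMap hb) f hf.1
    rwa [← subst_var_one f, hf.2.act_subst_var (F := shiftMap b) rfl 1] at this
  · rcases b with a | i
    · exact hf.2.subst_letter a
    · rw [hb i rfl]
      exact hf.2.subst_var 0

theorem map_subst_mem_gam {T : Set (FinA A)}
    (hstrong : ∀ F : ℕ → Symb A, IsStrong F → ∀ f ∈ T, act F f ∈ T) {b : Symb A}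
    (hb : ∀ i, b = Sum.inr i → i = 0) {U : Ultrafilter (FinA A)} (hU : U ∈ gam (layerOf T 1)) :
    U.map (subst b) ∈ gam (layerOf T 0) := by
  refine mem_gam_iff.2 ⟨?_, (isSymbolwise_subst b).isFree_map (isFree_of_mem_gam hU)⟩
  change ∀ᶠ f in (U : Filter (FinA A)), subst b f ∈ layerOf T 0
  filter_upwards [hU.1] with f hf using subst_mem_of_hasLayer_one hstrong hb hf

/-- The ultrafilter form of the Hales–Jewett theorem: substituting a letter or `x_0` for the
variable of `U_1` gives an idempotent below `U_0`, so `U_0` by minimality. -/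
theorem exists_variable_ultrafilter {T : Set (FinA A)} (hsub : IsSubsemigroup T)
    (hadequate : ∀ i : ℕ, IsAdequate (layerOf T i))
    (hstrong : ∀ F : ℕ → Symb A, IsStrong F → ∀ f ∈ T, act F f ∈ T) :
    ∃ U₀ ∈ gam (layerOf T 0), ∃ U₁ ∈ gam (layerOf T 1), U₀ + U₀ = U₀ ∧ U₁ + U₁ = U₁ ∧
      U₀ + U₁ = U₁ ∧ U₁ + U₀ = U₁ ∧
      ∀ b : Symb A, (∀ i, b = Sum.inr i → i = 0) → U₁.map (subst b) = U₀ := by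
  obtain ⟨U₀, hU₀, hidem, hmin⟩ := exists_minimal_idempotent continuous_uadd (gam (layerOf T 0))
    (hadequate 0).nonempty_gam (isClosed_gam _).isCompact
    fun x hx y hy => add_mem_gam_layerOf hsub (by simp) hx hy
  obtain ⟨U₁, hU₁, h11, h01, h10⟩ := exists_idempotent_below continuous_uadd hidem
    (gam (layerOf T 1)) (hadequate 1).nonempty_gam (isClosed_gam _).isCompact
    (fun x hx y hy => add_mem_gam_layerOf hsub (by simp) hx hy)
    (fun x hx => add_mem_gam_layerOf hsub (by simp) hU₀ hx)
    fun x hx => add_mem_gam_layerOf hsub (by simp) hx hU₀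
  refine ⟨U₀, hU₀, U₁, hU₁, hidem, h11, h01, h10, fun b hb => ?_⟩
  have hfix : U₀.map (subst b) = U₀ := map_eq_self_of_eventually <| by
    filter_upwards [hU₀.1] with f hf using hf.2.subst_eq_self b
  have hsw := isSymbolwise_subst b
  refine hmin _ (map_subst_mem_gam hstrong hb hU₁) ?_ ?_ ?_
  · rw [← hsw.map_uadd _ (isFree_of_mem_gam hU₁), h11]
  · nth_rw 1 [← hfix]
    rw [← hsw.map_uadd _ (isFree_of_mem_gam hU₁), h01]
  · nth_rw 1 [← hfix]
    rw [← hsw.map_uadd _ (isFree_of_mem_gam hU₀), h10]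

theorem exists_mem_strictCoherent {T : Set (FinA A)} (hsub : IsSubsemigroup T)
    (hadequate : ∀ i : ℕ, IsAdequate (layerOf T i))
    (hstrong : ∀ F : ℕ → Symb A, IsStrong F → ∀ f ∈ T, act F f ∈ T) (hcomplete : IsComplete T) :
    (strictCoherent T).Nonempty := by
  obtain ⟨U₀, hU₀, U₁, hU₁, h00, h11, h01, h10, hsubst⟩ :=
    exists_variable_ultrafilter hsub hadequate hstrong
  obtain ⟨Q, hQ⟩ : ∃ Q : ℕ → Ultrafilter (FinA A), ∀ i, Q i = U₁.map (subst (Sum.inr i)) :=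
    ⟨_, fun _ => rfl⟩
  have hQ0 : Q 0 = U₀ := (hQ 0).trans (hsubst _ fun i hi => (Sum.inr_injective hi).symm)
  have hQ1 : Q 1 = U₁ := (hQ 1).trans
    (map_eq_self_of_eventually (Eventually.of_forall subst_var_one))
  have hQfree (i) : IsFree (Q i) := by
    rw [hQ]
    exact (isSymbolwise_subst _).isFree_map (isFree_of_mem_gam hU₁)
  have hQQ (i) : Q i + Q i = Q i := by
    rw [hQ, ← (isSymbolwise_subst _).map_uadd _ (isFree_of_mem_gam hU₁), h11]
  have hQU (i) : Q i + U₀ = Q i := by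
    have hfix : U₀.map (subst (Sum.inr i)) = U₀ := map_eq_self_of_eventually <| by
      filter_upwards [hU₀.1] with f hf using hf.2.subst_eq_self _
    nth_rw 1 [← hfix]
    rw [hQ, ← (isSymbolwise_subst _).map_uadd _ (isFree_of_mem_gam hU₀), h10]
  have hlayer (i) : ∀ᶠ f in (Q i : Filter (FinA A)), f.HasLayer i := by
    rw [hQ]
    change ∀ᶠ f in (U₁ : Filter (FinA A)), (subst (Sum.inr i) f).HasLayer i
    filter_upwards [hU₁.1] with f hf using hf.2.subst_var i
  have hact (F : ℕ → Symb A) (hF : IsStrong F) (i) :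
      (Q i).map (act F) = U₁.map (subst (F i)) := by
    rw [hQ, Ultrafilter.map_map]
    refine map_congr_of_eventually ?_
    filter_upwards [hU₁.1] with f hf using hf.2.act_subst_var hF.map_zero i
  have hmulti (n : ℕ) : partialSum Q (n + 1) = multiSum U₁ n := by
    induction n with
    | zero => rw [partialSum, partialSum, hQ0, hQ1, h01, multiSum]
    | succ n ih => rw [partialSum, ih, hQ, multiSum, usum_eq_add]
  refine ⟨partialSum Q, fun i => ?_, fun F hF j => ?_⟩
  · cases i with
    | zero =>
      rw [partialSum, hQ0]
      exact hU₀
    | succ n =>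
      have hfl (j) : (∀ᶠ f in (partialSum Q j : Filter (FinA A)), f.HasLayer j) ∧
          IsFree (partialSum Q j) := by
        induction j with
        | zero => exact ⟨hlayer 0, hQfree 0⟩
        | succ j ih =>
          refine ⟨?_, ih.2.add (hQfree _)⟩
          have := eventually_hasLayer_uadd (hQfree (j + 1)) ih.1 (hlayer (j + 1))
          rwa [max_eq_right j.le_succ] at this
      refine mem_gam_layerOf_iff.2 ⟨?_, hfl (n + 1)⟩
      rw [hmulti]
      exact (hcomplete U₁ hU₁ n).2
  · induction j with
    | zero =>
      change (Q 0).map (act F) = Q 0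
      rw [hact F hF, hF.map_zero, hQ]
    | succ j ih =>
      rw [partialSum, (isSymbolwise_act F).map_uadd _ (hQfree _), ih, hact F hF]
      rcases hF.varBound_succ_cases j with ⟨a, hFj, h⟩ | ⟨hFj, h⟩ | ⟨hFj, h⟩
      · rw [h, hFj, hsubst _ fun i hi => absurd hi Sum.inl_ne_inr]
        cases varBound F j with
        | zero => rw [partialSum, hQU]
        | succ k => rw [partialSum, add_assoc, hQU]
      · rw [h, hFj, ← hQ, partialSum_add_self (hQQ _)]
      · rw [h, hFj, ← hQ, partialSum]

/-! ### Decreasing strictly coherent sequences -/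

/-- `u_0 ≽ u_1 ≽ ⋯ ≽ u_n`; the case `i = j` says that these are idempotents. -/
def OrderedUpTo (u : ℕ → Ultrafilter (FinA A)) (n : ℕ) : Prop :=
  ∀ i j, i ≤ j → j ≤ n → u i + u j = u j ∧ u j + u i = u j

theorem OrderedUpTo.partialSum_eq {u v : ℕ → Ultrafilter (FinA A)} {n : ℕ}
    (hu : OrderedUpTo u n) (hv : ∀ i ≤ n, v i = u i) : ∀ i ≤ n, partialSum v i = u i := by
  intro i
  induction i with
  | zero => exact hv 0
  | succ i ih =>
    intro hi
    rw [partialSum, ih (by omega), hv _ hi, (hu i (i + 1) i.le_succ hi).1]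

theorem OrderedUpTo.revPartialSum_eq {u v : ℕ → Ultrafilter (FinA A)} {n : ℕ}
    (hu : OrderedUpTo u n) (hv : ∀ i ≤ n, v i = u i) : ∀ i ≤ n, revPartialSum v i = u i := by
  intro i
  induction i with
  | zero => exact hv 0
  | succ i ih =>
    intro hi
    rw [revPartialSum, ih (by omega), hv _ hi, (hu i (i + 1) i.le_succ hi).2]

theorem isClosed_agreeUpTo (u : ℕ → Ultrafilter (FinA A)) (n : ℕ) :
    IsClosed {v : ℕ → Ultrafilter (FinA A) | ∀ i ≤ n, v i = u i} := by
  simp only [Set.ofPred_forall]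
  exact isClosed_iInter fun i => isClosed_iInter fun _ =>
    isClosed_eq (continuous_apply i) continuous_const

theorem exists_orderedUpTo_succ {T : Set (FinA A)} (hsub : IsSubsemigroup T)
    {u : ℕ → Ultrafilter (FinA A)} (hu : u ∈ strictCoherent T) {n : ℕ} (hord : OrderedUpTo u n) :
    ∃ w ∈ strictCoherent T, (∀ i ≤ n, w i = u i) ∧ OrderedUpTo w (n + 1) := by
  have hagree {v v' : ℕ → Ultrafilter (FinA A)} (hv : ∀ i ≤ n, v i = u i)
      (hv' : ∀ i ≤ n, v' i = u i) : ∀ i ≤ n, (v + v') i = u i := fun i hi => by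
    rw [Pi.add_apply, hv i hi, hv' i hi, (hord i i le_rfl hi).1]
  let C : Set (ℕ → Ultrafilter (FinA A)) := strictCoherent T ∩ {v | ∀ i ≤ n, v i = u i}
  have hC : IsClosed C := (isClosed_strictCoherent T).inter (isClosed_agreeUpTo u n)
  obtain ⟨v, hv, hvv⟩ := exists_idempotent_in_compact_add_subsemigroup continuous_seq_add C
    ⟨u, hu, fun _ _ => rfl⟩ hC.isCompact
    fun x hx y hy => ⟨add_mem_strictCoherent hsub hx.1 hy.1, hagree hx.2 hy.2⟩
  -- Only absorption on the right cuts out a closed set, since `x ↦ u n + x` need not be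
  -- continuous; absorption on the left is obtained afterwards from the partial sums.
  let D : Set (ℕ → Ultrafilter (FinA A)) := C ∩ {v | v (n + 1) + u n = v (n + 1)}
  have hD : IsClosed D := hC.inter (isClosed_eq
    ((continuous_uadd (u n)).comp (continuous_apply (n + 1))) (continuous_apply (n + 1)))
  have hDne : D.Nonempty := by
    refine ⟨revPartialSum v, ⟨revPartialSum_mem_strictCoherent hsub hv.1 fun i => congrFun hvv i,
      hord.revPartialSum_eq hv.2⟩, ?_⟩
    change revPartialSum v (n + 1) + u n = revPartialSum v (n + 1)
    rw [revPartialSum, hord.revPartialSum_eq hv.2 n le_rfl, add_assoc,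
      (hord n n le_rfl le_rfl).1]
  obtain ⟨w, ⟨⟨hwT, hwu⟩, hwn : w (n + 1) + u n = w (n + 1)⟩, hww⟩ :=
    exists_idempotent_in_compact_add_subsemigroup continuous_seq_add D hDne hD.isCompact
      fun x hx y hy => ⟨⟨add_mem_strictCoherent hsub hx.1.1 hy.1.1, hagree hx.1.2 hy.1.2⟩, by
        change x (n + 1) + y (n + 1) + u n = x (n + 1) + y (n + 1)
        rw [add_assoc, hy.2]⟩
  have hww' (i) : w i + w i = w i := congrFun hww i
  have hps := hord.partialSum_eq hwu
  have hlast : partialSum w (n + 1) = u n + w (n + 1) := by rw [partialSum, hps n le_rfl]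
  refine ⟨partialSum w, partialSum_mem_strictCoherent hsub hwT hww', hps, fun i j hij hj => ?_⟩
  rcases Nat.le_succ_iff.1 hj with hj | rfl
  · rw [hps i (hij.trans hj), hps j hj]
    exact hord i j hij hj
  rcases Nat.le_succ_iff.1 hij with hi | rfl
  · obtain ⟨h1, h2⟩ := hord i n hi le_rfl
    rw [hps i hi, hlast]
    refine ⟨by rw [← add_assoc, h1], ?_⟩
    rw [add_assoc]
    nth_rw 1 [← hwn]
    rw [add_assoc (w (n + 1)), h2, hwn]
  · have : u n + w (n + 1) + (u n + w (n + 1)) = u n + w (n + 1) := by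
      rw [add_assoc, ← add_assoc (w (n + 1)), hwn, hww']
    rw [hlast]
    exact ⟨this, this⟩

theorem exists_orderedUpTo_zero {T : Set (FinA A)} (hsub : IsSubsemigroup T)
    (hne : (strictCoherent T).Nonempty) : ∃ u ∈ strictCoherent T, OrderedUpTo u 0 := by
  obtain ⟨u, hu, huu⟩ := exists_idempotent_in_compact_add_subsemigroup continuous_seq_add _ hne
    (isClosed_strictCoherent T).isCompact fun x hx y hy => add_mem_strictCoherent hsub hx hy
  refine ⟨u, hu, fun i j hij hj => ?_⟩
  obtain rfl := Nat.le_zero.1 hj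
  obtain rfl := Nat.le_zero.1 hij
  exact ⟨congrFun huu 0, congrFun huu 0⟩

theorem exists_orderedUpTo_all {T : Set (FinA A)} (hsub : IsSubsemigroup T)
    (hne : (strictCoherent T).Nonempty) : ∃ u ∈ strictCoherent T, ∀ n, OrderedUpTo u n := by
  obtain ⟨u₀, hu₀, hord₀⟩ := exists_orderedUpTo_zero hsub hne
  choose! next hnextT hnextu hnexto using
    fun (u : ℕ → Ultrafilter (FinA A)) (n : ℕ) (h : u ∈ strictCoherent T ∧ OrderedUpTo u n) =>
      exists_orderedUpTo_succ hsub h.1 h.2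
  let s : ℕ → ℕ → Ultrafilter (FinA A) := fun n => Nat.rec u₀ (fun n u => next u n) n
  have hs (n) : s n ∈ strictCoherent T ∧ OrderedUpTo (s n) n := by
    induction n with
    | zero => exact ⟨hu₀, hord₀⟩
    | succ n ih => exact ⟨hnextT _ n ih, hnexto _ n ih⟩
  have hstable {i m : ℕ} (him : i ≤ m) : s m i = s i i := by
    induction m, him using Nat.le_induction with
    | base => rfl
    | succ m him ih => exact (hnextu _ m (hs m) i him).trans ih
  -- Strict coherence at `j` involves only the terms up to `j`, so it passes to the diagonal.
  refine ⟨fun i => s i i, ⟨fun i => (hs i).1.1 i, fun F hF j => ?_⟩, fun n i j hij hj => ?_⟩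
  · exact ((hs j).1.2 F hF j).trans (hstable (hF.varBound_le j))
  · have := (hs j).2 i j hij le_rfl
    rwa [hstable hij] at this

end FinA

theorem mainTheorem7 {A : Type*} [Finite A] (T : Set (FinA A))
    (hsub : FinA.IsSubsemigroup T)
    (hadequate : ∀ i : ℕ, FinA.IsAdequate (FinA.layerOf T i))
    (hstrong : ∀ F : ℕ → Symb A, FinA.IsStrong F → ∀ f ∈ T, FinA.act F f ∈ T)
    (hcomplete : FinA.IsComplete T) :
    FinA.IsFRamsey T := by
  obtain ⟨u, hu, hord⟩ := FinA.exists_orderedUpTo_all hsub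
    (FinA.exists_mem_strictCoherent hsub hadequate hstrong hcomplete)
  refine ⟨u, hu.1, fun F hF j => ⟨_, hF.varBound_le j, hu.2 F hF j⟩, fun i j hij => ?_⟩
  have hfree := FinA.isFree_of_mem_strictCoherent hu
  obtain ⟨hl, hr⟩ := hord j i j hij le_rfl
  exact ⟨(hfree i).uSumDefined _, (hfree j).uSumDefined _, hr, hl⟩
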